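/- Let $\mathbb{K}$ be $\mathbb{R}$ or $\mathbb{C}$. For a Banach space $X$ over $\mathbb{K}$, a weak$^*$-compact set $K\subseteq X^*$ and $\varepsilon>0$, let $s_\varepsilon(K)$ be the set of those $x^*\in K$ such that $\operatorname{diam}(V\cap K)>\varepsilon$ (norm diameter) for every weak$^*$-neighbourhood $V$ of $x^*$. Put $s^0_\varepsilon(K)=K$, $s^{\zeta+1}_\varepsilon(K)=s_\varepsilon(s^\zeta_\varepsilon(K))$, and $s^\zeta_\varepsilon(K)=\bigcap_{\eta<\zeta}s^\eta_\varepsilon(K)$ for limit ordinals $\zeta$. Let $Sz(K,\varepsilon)$ be the least ordinal $\zeta$ with $s^\zeta_\varepsilon(K)=\varnothing$ ($\infty$ if there is none) and $Sz(K)=\sup_{\varepsilon>0}Sz(K,\varepsilon)$. The Szlenk index of a bounded linear operator $A:X\to Y$ between Banach spaces is $Sz(A)=Sz(A^*B_{Y^*})$, where $B_{Y^*}$ is the closed unit ball of $Y^*$. **Theorem.** For every ordinal $\xi$, the class $\mathfrak{D}_\xi$ of all bounded linear operators $A$ between Banach spaces over $\mathbb{K}$ with $Sz(A)\leqslant\omega^\xi$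 is a closed operator ideal. That is, writing $\mathfrak{D}_\xi(X,Y)$ for the set of operators from $X$ to $Y$ in $\mathfrak{D}_\xi$: 1. if $C:W\to X$, $B:X\to Y$ and $A:Y\to Z$ are bounded linear operators between Banach spaces and $B\in\mathfrak{D}_\xi$, then $ABC\in\mathfrak{D}_\xi$; 2. the identity $I_{\mathbb{K}}$ of the scalar field belongs to $\mathfrak{D}_\xi$; 3. for all Banach spaces $X,Y$, the set $\mathfrak{D}_\xi(X,Y)$ is a linear subspace of the space $\mathfrak{L}(X,Y)$ of all bounded linear operators from $X$ to $Y$, and it is closed in the operator norm. -/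

import Mathlib

universe u v w

noncomputable section

open Set Topology
open scoped Ordinal

namespace Szlenk

section Derivation

variable {𝕜 : Type w} [RCLike 𝕜] {X : Type u} [NormedAddCommGroup X] [NormedSpace 𝕜 X]

/-- The set `s_ε(K)` of all `x ∈ K` such that every weak* neighbourhood `V` of `x` satisfies
`diam (V ∩ K) > ε`, the diameter being taken in the norm of the dual space. It is extended by
`s_ε(K) = K` for `ε ≤ 0`. -/
def derivSet (ε : ℝ) (K : Set (StrongDual 𝕜 X)) : Set (StrongDual 𝕜 X) :=
  {x ∈ K | 0 < ε → ∀ V ∈ 𝓝 (StrongDual.toWeakDual x),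
    ENNReal.ofReal ε < Metric.ediam (StrongDual.toWeakDual ⁻¹' V ∩ K)}

/-- The transfinite derivations: `s^0_ε(K) = K`, `s^{ζ+1}_ε(K) = s_ε(s^ζ_ε(K))`, and
`s^ζ_ε(K) = ⋂_{η < ζ} s^η_ε(K)` for a limit ordinal `ζ`. -/
def iterDeriv (ε : ℝ) (K : Set (StrongDual 𝕜 X)) (ζ : Ordinal.{v}) : Set (StrongDual 𝕜 X) :=
  Ordinal.limitRecOn (motive := fun _ => Set (StrongDual 𝕜 X)) ζ
    K
    (fun _ S => derivSet ε S)
    (fun ζ _ S => ⋂ (η : Ordinal.{v}) (h : η < ζ), S η h)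

/-- `Sz(K, ε)`: the least ordinal `ζ` with `s^ζ_ε(K) = ∅`, and `⊤` (that is, `∞`) if there is
none. -/
def indexAt (K : Set (StrongDual 𝕜 X)) (ε : ℝ) : WithTop Ordinal.{v} :=
  sInf ((fun ζ : Ordinal.{v} => (ζ : WithTop Ordinal.{v})) ''
    {ζ : Ordinal.{v} | iterDeriv ε K ζ = ∅})

/-- The Szlenk index `Sz(K) = sup_{ε > 0} Sz(K, ε)`. -/
def index (K : Set (StrongDual 𝕜 X)) : WithTop Ordinal.{v} :=
  ⨆ (ε : ℝ) (_ : 0 < ε), indexAt.{u, v, w} K ε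

variable {Y : Type u} [NormedAddCommGroup Y] [NormedSpace 𝕜 Y]

/-- The set `A^* B_{Y^*}`, the image under the adjoint `A^* : Y^* → X^*`, `f ↦ f ∘ A`, of the
closed unit ball of `Y^*`. -/
def adjointBall (A : X →L[𝕜] Y) : Set (StrongDual 𝕜 X) :=
  (fun f : StrongDual 𝕜 Y => f.comp A) '' Metric.closedBall (0 : StrongDual 𝕜 Y) 1

/-- The Szlenk index `Sz(A) = Sz(A^* B_{Y^*})` of an operator `A : X → Y`. -/
def opIndex (A : X →L[𝕜] Y) : WithTop Ordinal.{v} :=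
  index.{u, v, w} (adjointBall A)

end Derivation

/-- A class of (bounded linear) operators between Banach spaces over `𝕜`, given by its
components `I(X, Y) ⊆ L(X, Y)`. -/
def OperatorClass (𝕜 : Type) [RCLike 𝕜] : Type (u + 1) :=
  ∀ (X Y : Type u) [NormedAddCommGroup X] [NormedSpace 𝕜 X] [CompleteSpace X]
    [NormedAddCommGroup Y] [NormedSpace 𝕜 Y] [CompleteSpace Y], Set (X →L[𝕜] Y)

/-- A class of operators is an operator ideal if it is stable under composition with arbitrary
operators on both sides, contains the identity of the scalar field (regarded as a Banach space in
the universe at hand) and has linear subspaces as its components. -/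
structure IsOperatorIdeal {𝕜 : Type} [RCLike 𝕜] (I : OperatorClass.{u} 𝕜) : Prop where
  comp_mem : ∀ (W X Y Z : Type u)
    [NormedAddCommGroup W] [NormedSpace 𝕜 W] [CompleteSpace W]
    [NormedAddCommGroup X] [NormedSpace 𝕜 X] [CompleteSpace X]
    [NormedAddCommGroup Y] [NormedSpace 𝕜 Y] [CompleteSpace Y]
    [NormedAddCommGroup Z] [NormedSpace 𝕜 Z] [CompleteSpace Z]
    (C : W →L[𝕜] X) (B : X →L[𝕜] Y) (A : Y →L[𝕜] Z), B ∈ I X Y → A ∘L B ∘L C ∈ I W Z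
  id_mem : ContinuousLinearMap.id 𝕜 (ULift.{u} 𝕜) ∈ I (ULift.{u} 𝕜) (ULift.{u} 𝕜)
  isSubspace : ∀ (X Y : Type u)
    [NormedAddCommGroup X] [NormedSpace 𝕜 X] [CompleteSpace X]
    [NormedAddCommGroup Y] [NormedSpace 𝕜 Y] [CompleteSpace Y],
    ∃ S : Submodule 𝕜 (X →L[𝕜] Y), (S : Set (X →L[𝕜] Y)) = I X Y

/-- An operator ideal is closed if each `I(X, Y)` is closed in `L(X, Y)` for the operator norm. -/
structure IsClosedOperatorIdeal {𝕜 : Type} [RCLike 𝕜] (I : OperatorClass.{u} 𝕜) : Prop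
    extends IsOperatorIdeal I where
  isClosed : ∀ (X Y : Type u)
    [NormedAddCommGroup X] [NormedSpace 𝕜 X] [CompleteSpace X]
    [NormedAddCommGroup Y] [NormedSpace 𝕜 Y] [CompleteSpace Y], IsClosed (I X Y)

/-- The class of all operators `A` with `Sz(A) ≤ ω^ξ`. -/
def szlenkClass (𝕜 : Type) [RCLike 𝕜] (ξ : Ordinal.{v}) : OperatorClass.{u} 𝕜 :=
  fun X Y _ _ _ _ _ _ =>
    {A : X →L[𝕜] Y | opIndex.{u, v, 0} A ≤ ((ω ^ ξ : Ordinal.{v}) : WithTop Ordinal.{v})}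

end Szlenk

end

noncomputable section

open Set Topology Filter
open scoped Ordinal

namespace Szlenk

/-! ### The natural sum of ordinals -/

/-! The bound `Sz(A) ≤ θ` is traded for rank functions on the weak* compact dual ball
(`opIndex_le_iff_hasRank`). Given a bound on the index, the last derived set containing `A^* f` is
such a rank; conversely, compactness shows that any rank function dominates the derivation
(`exists_le_rank_of_mem_iterDeriv`). Stability is then direct. Composition pulls ranks back along a
scaled adjoint, and a norm limit borrows the rank of a nearby operator. For `A + B` the two ranks
are combined by the natural sum: its strict monotonicity in both arguments makes a constant sum
force both ranks constant, and `ω^ξ` is closed under it. -/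

/-- The natural (Hessenberg) sum of two ordinals. -/
def nadd (a b : Ordinal.{v}) : Ordinal.{v} :=
  max (⨆ x : Iio a, Order.succ (nadd x.1 b)) (⨆ x : Iio b, Order.succ (nadd a x.1))
termination_by (a, b)
decreasing_by all_goals cases x; decreasing_tactic

theorem nadd_le_iff {a b c : Ordinal.{v}} :
    nadd a b ≤ c ↔ (∀ x < a, nadd x b < c) ∧ ∀ y < b, nadd a y < c := by
  rw [nadd, max_le_iff, Ordinal.iSup_le_iff, Ordinal.iSup_le_iff]
  simp

theorem nadd_lt_nadd_right {a a' : Ordinal.{v}} (h : a < a') (b : Ordinal.{v}) :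
    nadd a b < nadd a' b :=
  (nadd_le_iff.1 le_rfl).1 a h

theorem nadd_lt_nadd_left {b b' : Ordinal.{v}} (a : Ordinal.{v}) (h : b < b') :
    nadd a b < nadd a b' :=
  (nadd_le_iff.1 le_rfl).2 b h

theorem nadd_le_nadd {a a' b b' : Ordinal.{v}} (ha : a ≤ a') (hb : b ≤ b') :
    nadd a b ≤ nadd a' b' :=
  (StrictMono.monotone (fun _ _ h => nadd_lt_nadd_right h b) ha).trans
    (StrictMono.monotone (fun _ _ h => nadd_lt_nadd_left a' h) hb)

theorem eq_and_eq_of_nadd_eq {a a' b b' : Ordinal.{v}} (ha : a ≤ a') (hb : b ≤ b')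
    (h : nadd a b = nadd a' b') : a = a' ∧ b = b' := by
  constructor
  · refine ha.eq_of_not_lt fun hlt => h.not_lt ?_
    exact (nadd_le_nadd le_rfl hb).trans_lt (nadd_lt_nadd_right hlt b')
  · refine hb.eq_of_not_lt fun hlt => h.not_lt ?_
    exact (nadd_le_nadd ha le_rfl).trans_lt (nadd_lt_nadd_left a' hlt)

/-- Induction on the pair. Lowering an argument lowers either its coefficient of `d`, and closure of
`d` absorbs any new remainders, or only its remainder. -/
theorem nadd_mul_add_le {d : Ordinal.{v}} (hd : ∀ a < d, ∀ b < d, nadd a b < d)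
    (a b : Ordinal.{v}) (n m : ℕ) (a' b' : Ordinal.{v}) (ha' : a' < d) (hb' : b' < d)
    (ha : a = d * n + a') (hb : b = d * m + b') :
    nadd a b ≤ d * ((n + m : ℕ) : Ordinal.{v}) + nadd a' b' := by
  have step : ∀ k l : ℕ, k < l → ∀ r < d, d * (k : Ordinal.{v}) + r < d * (l : Ordinal.{v}) := by
    intro k l hkl r hr
    calc d * (k : Ordinal.{v}) + r < d * (k : Ordinal.{v}) + d := by gcongr
      _ = d * ((k + 1 : ℕ) : Ordinal.{v}) := by push_cast; rw [mul_add_one]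
      _ ≤ d * (l : Ordinal.{v}) := by gcongr; exact hkl
  have split : ∀ (k : ℕ) (s x : Ordinal.{v}), x < d * k + s →
      (∃ q : ℕ, q < k ∧ ∃ r < d, x = d * q + r) ∨ ∃ r < s, x = d * k + r := by
    intro k s x hx
    rcases lt_or_ge x (d * k) with h | h
    · obtain ⟨q, hq, r, hr, rfl⟩ := Ordinal.lt_mul_iff.1 h
      obtain ⟨q, rfl⟩ := Ordinal.lt_omega0.1 (hq.trans (Ordinal.natCast_lt_omega0 k))
      exact Or.inl ⟨q, by exact_mod_cast hq, r, hr, rfl⟩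
    · refine Or.inr ⟨x - d * k, ?_, (Ordinal.add_sub_cancel_of_le h).symm⟩
      rwa [← add_lt_add_iff_left (d * (k : Ordinal.{v})), Ordinal.add_sub_cancel_of_le h]
  rw [nadd_le_iff]
  refine ⟨fun x hx => ?_, fun y hy => ?_⟩
  · have hx' := hx
    rw [ha] at hx'
    rcases split n a' x hx' with ⟨q, hq, r, hr, hxr⟩ | ⟨r, hr, hxr⟩
    · calc nadd x b ≤ d * ((q + m : ℕ) : Ordinal.{v}) + nadd r b' :=
            nadd_mul_add_le hd x b q m r b' hr hb' hxr hb
        _ < d * ((n + m : ℕ) : Ordinal.{v}) := step _ _ (by omega) _ (hd _ hr _ hb')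
        _ ≤ _ := le_self_add
    · refine (nadd_mul_add_le hd x b n m r b' (hr.trans ha') hb' hxr hb).trans_lt ?_
      gcongr
      exact nadd_lt_nadd_right hr b'
  · have hy' := hy
    rw [hb] at hy'
    rcases split m b' y hy' with ⟨q, hq, r, hr, hyr⟩ | ⟨r, hr, hyr⟩
    · calc nadd a y ≤ d * ((n + q : ℕ) : Ordinal.{v}) + nadd a' r :=
            nadd_mul_add_le hd a y n q a' r ha' hr ha hyr
        _ < d * ((n + m : ℕ) : Ordinal.{v}) := step _ _ (by omega) _ (hd _ ha' _ hr)
        _ ≤ _ := le_self_add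
    · refine (nadd_mul_add_le hd a y n m a' r ha' (hr.trans hb') ha hyr).trans_lt ?_
      gcongr
      exact nadd_lt_nadd_left a' hr
termination_by (a, b)

/-- Powers of `ω` are closed under natural sums. -/
theorem nadd_lt_omega0_opow (e : Ordinal.{v}) :
    ∀ a < (ω : Ordinal.{v}) ^ e, ∀ b < (ω : Ordinal.{v}) ^ e, nadd a b < ω ^ e := by
  induction e using WellFoundedLT.induction with
  | _ e ih =>
  intro a ha b hb
  rcases eq_or_ne e 0 with rfl | he
  · rw [Ordinal.opow_zero, Order.lt_one_iff] at ha hb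
    subst ha hb
    refine lt_of_le_of_lt (b := 0) (nadd_le_iff.2 ⟨fun x hx => ?_, fun x hx => ?_⟩) (by simp)
    · exact absurd hx not_lt_zero
    · exact absurd hx not_lt_zero
  · obtain ⟨c, hc, n, hn⟩ := (Ordinal.lt_omega0_opow he).1 (max_lt ha hb)
    have hpos : (0 : Ordinal.{v}) < ω ^ c := Ordinal.opow_pos c Ordinal.omega0_pos
    -- Both arguments lie below one `ω^c * n` with `c < e`, so their natural sum stays below `ω^c *
    -- (2n + 1)`.
    have hle := nadd_mul_add_le (ih c hc) (ω ^ c * n) (ω ^ c * n) n n 0 0 hpos hpos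
      (by simp) (by simp)
    refine (nadd_le_nadd ((le_max_left a b).trans hn.le) ((le_max_right a b).trans hn.le)).trans_lt
      (hle.trans_lt ?_)
    refine (add_lt_add_right (ih c hc 0 hpos 0 hpos) _).trans ?_
    rw [← mul_add_one, ← Nat.cast_add_one]
    exact Ordinal.opow_mul_lt_opow (Ordinal.natCast_lt_omega0 _) hc

/-! ### Transfinite derivations -/

section Derivation

variable {𝕜 : Type w} [RCLike 𝕜] {X : Type u} [NormedAddCommGroup X] [NormedSpace 𝕜 X]

theorem derivSet_subset (ε : ℝ) (K : Set (StrongDual 𝕜 X)) : derivSet ε K ⊆ K :=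
  sep_subset _ _

theorem iterDeriv_zero (ε : ℝ) (K : Set (StrongDual 𝕜 X)) :
    iterDeriv ε K (0 : Ordinal.{v}) = K :=
  Ordinal.limitRecOn_zero ..

theorem iterDeriv_add_one (ε : ℝ) (K : Set (StrongDual 𝕜 X)) (ζ : Ordinal.{v}) :
    iterDeriv ε K (ζ + 1) = derivSet ε (iterDeriv ε K ζ) :=
  Ordinal.limitRecOn_add_one ..

theorem iterDeriv_limit (ε : ℝ) (K : Set (StrongDual 𝕜 X)) {ζ : Ordinal.{v}}
    (h : Order.IsSuccLimit ζ) :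
    iterDeriv ε K ζ = ⋂ (η : Ordinal.{v}) (_ : η < ζ), iterDeriv ε K η :=
  Ordinal.limitRecOn_limit _ _ _ _ h

theorem iterDeriv_antitone (ε : ℝ) (K : Set (StrongDual 𝕜 X)) :
    Antitone (iterDeriv ε K : Ordinal.{v} → Set (StrongDual 𝕜 X)) := by
  intro η ζ h
  induction ζ using Ordinal.limitRecOn with
  | zero => rw [nonpos_iff_eq_zero.1 h]
  | add_one ζ ih =>
    rcases h.eq_or_lt with rfl | h
    · exact le_rfl
    · rw [iterDeriv_add_one]
      exact (derivSet_subset _ _).trans (ih (Order.lt_add_one_iff.1 h))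
  | limit ζ hζ _ =>
    rcases h.eq_or_lt with rfl | h
    · exact le_rfl
    · rw [iterDeriv_limit ε K hζ]
      exact iInter₂_subset η h

theorem exists_nhds_of_notMem_derivSet {ε : ℝ} {K : Set (StrongDual 𝕜 X)} {x : StrongDual 𝕜 X}
    (hx : x ∈ K) (h : x ∉ derivSet ε K) :
    0 < ε ∧ ∃ V ∈ 𝓝 (StrongDual.toWeakDual x),
      Metric.ediam (StrongDual.toWeakDual ⁻¹' V ∩ K) ≤ ENNReal.ofReal ε := by
  simp only [derivSet, mem_ofPred_eq, not_and, not_forall, not_lt, exists_prop] at h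
  exact h hx

/-- The derived sets are relatively weak* closed. -/
theorem eventually_notMem_iterDeriv {ε : ℝ} {K : Set (StrongDual 𝕜 X)} (ζ : Ordinal.{v})
    {x : StrongDual 𝕜 X} (hx : x ∈ K) (h : x ∉ iterDeriv ε K ζ) :
    ∀ᶠ y in 𝓝 (StrongDual.toWeakDual x), WeakDual.toStrongDual y ∉ iterDeriv ε K ζ := by
  induction ζ using Ordinal.limitRecOn with
  | zero => rw [iterDeriv_zero] at h; exact absurd hx h
  | add_one ζ ih =>
    rw [iterDeriv_add_one] at h ⊢
    by_cases hζ : x ∈ iterDeriv ε K ζ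
    · obtain ⟨hε, V, hV, hd⟩ := exists_nhds_of_notMem_derivSet hζ h
      filter_upwards [eventually_mem_nhds_iff.2 hV] with y hy hmem
      exact (hmem.2 hε V hy).not_ge hd
    · filter_upwards [ih hζ] with y hy hmem
      exact hy hmem.1
  | limit ζ hζ ih =>
    rw [iterDeriv_limit ε K hζ] at h ⊢
    simp only [mem_iInter, not_forall] at h
    obtain ⟨η, hη, hxη⟩ := h
    filter_upwards [ih η hη hxη] with y hy hmem
    exact hy (mem_iInter₂.1 hmem η hη)

/-- The Szlenk rank of a point: the last derived set to which it belongs. -/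
def rank (ε : ℝ) (K : Set (StrongDual 𝕜 X)) (x : StrongDual 𝕜 X) : Ordinal.{v} :=
  sInf {α | x ∉ iterDeriv ε K (α + 1)}

/-- Limit stages are intersections, so a point first drops out at a successor stage. Emptiness at
`θ` keeps the infimum off its default value `0`. -/
theorem rank_spec {ε : ℝ} {K : Set (StrongDual 𝕜 X)} {θ : Ordinal.{v}}
    (hθ : iterDeriv ε K θ = ∅) {x : StrongDual 𝕜 X} (hx : x ∈ K) :
    (rank ε K x : Ordinal.{v}) < θ ∧ x ∈ iterDeriv ε K (rank ε K x : Ordinal.{v}) ∧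
      x ∉ iterDeriv ε K ((rank ε K x : Ordinal.{v}) + 1) := by
  have hmem : x ∉ iterDeriv ε K ((rank ε K x : Ordinal.{v}) + 1) := by
    refine csInf_mem (s := {α : Ordinal.{v} | x ∉ iterDeriv ε K (α + 1)}) ⟨θ, fun h => ?_⟩
    simpa [hθ] using iterDeriv_antitone ε K (le_self_add : θ ≤ θ + 1) h
  have hin : ∀ α : Ordinal.{v}, α ≤ rank ε K x → x ∈ iterDeriv ε K α := by
    intro α
    induction α using Ordinal.limitRecOn with
    | zero => intro _; rwa [iterDeriv_zero]
    | add_one α _ =>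
      intro h
      by_contra hc
      exact (Order.add_one_le_iff.1 h).not_ge (csInf_le' hc)
    | limit α hα ih =>
      intro h
      rw [iterDeriv_limit ε K hα]
      exact mem_iInter₂.2 fun η hη => ih η hη (hη.le.trans h)
  refine ⟨lt_of_not_ge fun hle => ?_, hin _ le_rfl, hmem⟩
  simpa [hθ] using hin θ hle

theorem index_le_iff {K : Set (StrongDual 𝕜 X)} {θ : Ordinal.{v}} :
    index.{u, v, w} K ≤ (θ : WithTop Ordinal.{v}) ↔ ∀ ε : ℝ, 0 < ε → iterDeriv ε K θ = ∅ := by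
  simp only [index, iSup_le_iff]
  refine forall₂_congr fun ε _ => ⟨fun h => ?_, fun h => sInf_le ⟨θ, h, rfl⟩⟩
  -- An infimum over the empty set would be `⊤`, against the bound; hence it is attained.
  have hne : ((fun ζ : Ordinal.{v} => (ζ : WithTop Ordinal.{v})) ''
      {ζ : Ordinal.{v} | iterDeriv ε K ζ = ∅}).Nonempty := by
    by_contra hne
    rw [not_nonempty_iff_eq_empty] at hne
    rw [indexAt, hne, sInf_empty] at h
    exact WithTop.coe_ne_top (top_le_iff.1 h)
  obtain ⟨ζ, hζ, hζe⟩ := csInf_mem hne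
  have hle : ζ ≤ θ := by
    rw [← WithTop.coe_le_coe]
    exact hζe.trans_le h
  exact subset_eq_empty (iterDeriv_antitone ε K hle) hζ

end Derivation

/-! ### Rank functions on the dual ball -/

section Rank

variable {𝕜 : Type w} [RCLike 𝕜] {X Y : Type u} [NormedAddCommGroup X] [NormedSpace 𝕜 X]
  [NormedAddCommGroup Y] [NormedSpace 𝕜 Y]

/-- The closed unit ball of the dual space, with the weak* topology. -/
def weakBall (𝕜 : Type w) [RCLike 𝕜] (Y : Type u) [NormedAddCommGroup Y] [NormedSpace 𝕜 Y] :
    Set (WeakDual 𝕜 Y) :=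
  WeakDual.toStrongDual ⁻¹' Metric.closedBall (0 : StrongDual 𝕜 Y) 1

/-- The adjoint of an operator. -/
def adj (A : X →L[𝕜] Y) (f : WeakDual 𝕜 Y) : StrongDual 𝕜 X :=
  (WeakDual.toStrongDual f).comp A

theorem adj_mem (A : X →L[𝕜] Y) {f : WeakDual 𝕜 Y} (hf : f ∈ weakBall 𝕜 Y) :
    adj A f ∈ adjointBall A :=
  ⟨_, hf, rfl⟩

theorem continuous_toWeakDual_adj (A : X →L[𝕜] Y) :
    Continuous fun f => StrongDual.toWeakDual (adj A f) :=
  WeakDual.continuous_of_continuous_eval fun x => WeakDual.eval_continuous (A x)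

/-- For each `ε > 0` there is an upper semicontinuous ordinal function `ρ < θ` on the dual ball
such that the adjoint of `A` oscillates by at most `ε` near each point of each level set. -/
def HasRank (A : X →L[𝕜] Y) (θ : Ordinal.{v}) : Prop :=
  ∀ ε : ℝ, 0 < ε → ∃ ρ : WeakDual 𝕜 Y → Ordinal.{v}, ∀ f ∈ weakBall 𝕜 Y, ρ f < θ ∧
    ∀ᶠ g in 𝓝[weakBall 𝕜 Y] f, ρ g ≤ ρ f ∧ (ρ g = ρ f → ‖adj A g - adj A f‖ ≤ ε)

theorem hasRank_of_opIndex_le {A : X →L[𝕜] Y} {θ : Ordinal.{v}}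
    (h : opIndex.{u, v, w} A ≤ (θ : WithTop Ordinal.{v})) : HasRank A θ := by
  intro ε hε
  have hθ := index_le_iff.1 h ε hε
  refine ⟨fun f => rank ε (adjointBall A) (adj A f), fun f hf => ?_⟩
  obtain ⟨hlt, hmem, hnot⟩ := rank_spec hθ (adj_mem A hf)
  refine ⟨hlt, ?_⟩
  have hcont := (continuous_toWeakDual_adj A).tendsto f
  have h1 := hcont.eventually (eventually_notMem_iterDeriv _ (adj_mem A hf) hnot)
  rw [iterDeriv_add_one] at hnot
  obtain ⟨-, V, hV, hd⟩ := exists_nhds_of_notMem_derivSet hmem hnot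
  filter_upwards [nhdsWithin_le_nhds h1, nhdsWithin_le_nhds (hcont.eventually_mem hV),
    self_mem_nhdsWithin] with g hg hgV hgB
  refine ⟨csInf_le' hg, fun heq => ?_⟩
  have hg' := (rank_spec hθ (adj_mem A hgB)).2.1
  rw [heq] at hg'
  have hfV : StrongDual.toWeakDual (adj A f) ∈ V := mem_of_mem_nhds hV
  have := Metric.edist_le_of_ediam_le (x := adj A g) (y := adj A f) (mem_inter hgV hg')
    (mem_inter hfV hmem) hd
  rwa [edist_dist, ENNReal.ofReal_le_ofReal_iff hε.le, dist_eq_norm] at this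

theorem isCompact_weakBall : IsCompact (weakBall 𝕜 Y) :=
  WeakDual.isCompact_closedBall 0 1

theorem exists_le_rank_of_mem_iterDeriv {A : X →L[𝕜] Y} {ε δ : ℝ} (hε : 0 < ε) (hδ : 2 * δ ≤ ε)
    {ρ : WeakDual 𝕜 Y → Ordinal.{v}}
    (hρ : ∀ f ∈ weakBall 𝕜 Y, ∀ᶠ g in 𝓝[weakBall 𝕜 Y] f,
      ρ g ≤ ρ f ∧ (ρ g = ρ f → ‖adj A g - adj A f‖ ≤ δ))
    (ζ : Ordinal.{v}) {z : StrongDual 𝕜 X} (hz : z ∈ iterDeriv ε (adjointBall A) ζ) :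
    ∃ f ∈ weakBall 𝕜 Y, adj A f = z ∧ ζ ≤ ρ f := by
  induction ζ using Ordinal.limitRecOn generalizing z with
  | zero =>
    rw [iterDeriv_zero] at hz
    obtain ⟨f, hf, rfl⟩ := hz
    exact ⟨StrongDual.toWeakDual f, hf, rfl, zero_le⟩
  | add_one ζ ih =>
    by_contra! hcon
    simp only [Order.lt_add_one_iff] at hcon
    rw [iterDeriv_add_one] at hz
    -- Tube lemma: near `z`, only preimages close to those of `z` matter, and these have rank at
    -- most `ζ`. Ball membership is repeated because the lemma tests full neighbourhoods, whereas
    -- `hρ` is relative to the ball.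
    have key : ∀ᶠ y in 𝓝 (StrongDual.toWeakDual z), ∀ f ∈ weakBall 𝕜 Y,
        f ∈ weakBall 𝕜 Y → ζ ≤ ρ f → StrongDual.toWeakDual (adj A f) = y →
          ‖WeakDual.toStrongDual y - z‖ ≤ δ := by
      refine isCompact_weakBall.eventually_forall_of_forall_eventually fun f hf => ?_
      by_cases hfz : adj A f = z
      · have := eventually_nhdsWithin_iff.1 (hρ f hf)
        filter_upwards [continuous_snd.continuousAt.eventually this] with p hp hpB hpζ hpy
        obtain ⟨h1, h2⟩ := hp hpB
        rw [← hpy, ← hfz]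
        exact h2 (h1.antisymm ((hcon f hf hfz).trans hpζ))
      · have hopen : IsOpen {p : WeakDual 𝕜 X × WeakDual 𝕜 Y |
            StrongDual.toWeakDual (adj A p.2) ≠ p.1} :=
          isOpen_ne_fun ((continuous_toWeakDual_adj A).comp continuous_snd) continuous_fst
        have hmem : (StrongDual.toWeakDual z, f) ∈ {p : WeakDual 𝕜 X × WeakDual 𝕜 Y |
            StrongDual.toWeakDual (adj A p.2) ≠ p.1} :=
          fun h => hfz (StrongDual.toWeakDual.injective h)
        filter_upwards [hopen.mem_nhds hmem] with p hp _ _ hpy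
        exact absurd hpy hp
    refine (hz.2 hε _ key).not_ge (Metric.ediam_le_of_forall_dist_le fun x hx y hy => ?_)
    have aux : ∀ x ∈ StrongDual.toWeakDual ⁻¹' {y | ∀ f ∈ weakBall 𝕜 Y,
        f ∈ weakBall 𝕜 Y → ζ ≤ ρ f → StrongDual.toWeakDual (adj A f) = y →
          ‖WeakDual.toStrongDual y - z‖ ≤ δ} ∩ iterDeriv ε (adjointBall A) ζ, dist x z ≤ δ := by
      rintro x ⟨hx, hxζ⟩
      obtain ⟨f, hf, rfl, hfζ⟩ := ih hxζ
      rw [dist_eq_norm]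
      exact hx f hf hf hfζ rfl
    have := dist_triangle_right x y z
    linarith [aux x hx, aux y hy]
  | limit ζ hζ ih =>
    have hex : ∀ η : Iio ζ, ∃ f ∈ weakBall 𝕜 Y, adj A f = z ∧ η.1 ≤ ρ f := by
      rintro ⟨η, hη⟩
      rw [iterDeriv_limit _ _ hζ] at hz
      exact ih η hη (mem_iInter₂.1 hz η hη)
    choose F hFB hFz hFρ using hex
    have : Nonempty (Iio ζ) := ⟨⟨0, hζ.bot_lt⟩⟩
    -- A cluster point of preimages of rank at least `η`, as `η → ζ`; semicontinuity forbids its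
    -- rank from being below `ζ`.
    obtain ⟨f, hf, hcl⟩ := isCompact_weakBall.exists_mapClusterPt (f := (atTop : Filter (Iio ζ)))
      (u := F) (tendsto_principal.2 (Eventually.of_forall hFB))
    have hclosed : IsClosed {g : WeakDual 𝕜 Y |
        StrongDual.toWeakDual (adj A g) = StrongDual.toWeakDual z} :=
      isClosed_eq (continuous_toWeakDual_adj A) continuous_const
    refine ⟨f, hf, ?_, ?_⟩
    · refine StrongDual.toWeakDual.injective (hclosed.mem_of_mapClusterPt hcl ?_)
      exact Eventually.of_forall fun η => congrArg _ (hFz η)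
    · by_contra! hlt
      have h1 := hcl.frequently (eventually_nhdsWithin_iff.1 (hρ f hf))
      have h2 : ∀ᶠ η : Iio ζ in atTop, ρ f + 1 ≤ η.1 :=
        eventually_ge_atTop (⟨ρ f + 1, hζ.add_one_lt hlt⟩ : Iio ζ)
      obtain ⟨η, hη1, hη2⟩ := (h1.and_eventually h2).exists
      have := (hη2.trans (hFρ η)).trans (hη1 (hFB η)).1
      exact (Order.lt_add_one_iff.2 le_rfl).not_ge this

theorem opIndex_le_iff_hasRank {A : X →L[𝕜] Y} {θ : Ordinal.{v}} :
    opIndex.{u, v, w} A ≤ (θ : WithTop Ordinal.{v}) ↔ HasRank A θ := by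
  refine ⟨hasRank_of_opIndex_le, fun h => index_le_iff.2 fun ε hε => ?_⟩
  obtain ⟨ρ, hρ⟩ := h (ε / 2) (by positivity)
  refine eq_empty_of_forall_notMem fun z hz => ?_
  obtain ⟨f, hf, -, hle⟩ := exists_le_rank_of_mem_iterDeriv hε (δ := ε / 2) (by linarith)
    (fun f hf => (hρ f hf).2) θ hz
  exact ((hρ f hf).1).not_ge hle

/-! ### Stability properties -/

theorem hasRank_zero {θ : Ordinal.{v}} (hθ : 0 < θ) : HasRank (0 : X →L[𝕜] Y) θ := by
  refine fun ε hε => ⟨fun _ => 0, fun f _ => ⟨hθ, Eventually.of_forall fun g => ⟨le_rfl, ?_⟩⟩⟩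
  simp [adj, hε.le]

theorem HasRank.add {A B : X →L[𝕜] Y} {θ : Ordinal.{v}}
    (hθ : ∀ a < θ, ∀ b < θ, nadd a b < θ) (hA : HasRank A θ) (hB : HasRank B θ) :
    HasRank (A + B) θ := by
  intro ε hε
  obtain ⟨ρ, hρ⟩ := hA (ε / 2) (by positivity)
  obtain ⟨σ, hσ⟩ := hB (ε / 2) (by positivity)
  refine ⟨fun f => nadd (ρ f) (σ f), fun f hf =>
    ⟨hθ _ (hρ f hf).1 _ (hσ f hf).1, ?_⟩⟩
  filter_upwards [(hρ f hf).2, (hσ f hf).2] with g hg hg'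
  refine ⟨nadd_le_nadd hg.1 hg'.1, fun h => ?_⟩
  obtain ⟨h1, h2⟩ := eq_and_eq_of_nadd_eq hg.1 hg'.1 h
  have : adj (A + B) g - adj (A + B) f = (adj A g - adj A f) + (adj B g - adj B f) := by
    simp only [adj, ContinuousLinearMap.comp_add]; abel
  rw [this]
  linarith [norm_add_le (adj A g - adj A f) (adj B g - adj B f), hg.2 h1, hg'.2 h2]

theorem HasRank.comp {W Z : Type u} [NormedAddCommGroup W] [NormedSpace 𝕜 W]
    [NormedAddCommGroup Z] [NormedSpace 𝕜 Z] {B : X →L[𝕜] Y} {θ : Ordinal.{v}}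
    (hB : HasRank B θ) (A : Y →L[𝕜] Z) (C : W →L[𝕜] X) : HasRank (A ∘L B ∘L C) θ := by
  intro ε hε
  -- The `+ 1` keeps the scalars positive; `T = a⁻¹ A^*` maps ball to ball, and `(ABC)^* = a C^* B^*
  -- T`.
  set a : ℝ := ‖A‖ + 1 with ha_def
  have ha : 0 < a := by positivity
  set c : ℝ := ‖C‖ + 1 with hc_def
  have hc : 0 < c := by positivity
  obtain ⟨ρ, hρ⟩ := hB (ε / (a * c)) (by positivity)
  set s : 𝕜 := ((a⁻¹ : ℝ) : 𝕜) with hs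
  have hsa : (a : 𝕜) * s = 1 := by
    rw [hs, ← RCLike.ofReal_mul, mul_inv_cancel₀ ha.ne', RCLike.ofReal_one]
  let T : WeakDual 𝕜 Z → WeakDual 𝕜 Y := fun f => s • StrongDual.toWeakDual (adj A f)
  have hTc : Continuous T := (continuous_toWeakDual_adj A).const_smul s
  have hTm : MapsTo T (weakBall 𝕜 Z) (weakBall 𝕜 Y) := by
    intro f hf
    have hf' : ‖WeakDual.toStrongDual f‖ ≤ 1 := by simpa [weakBall] using hf
    have hn : ‖s • adj A f‖ ≤ 1 := by
      rw [norm_smul, hs, RCLike.norm_ofReal, abs_of_pos (inv_pos.2 ha), inv_mul_le_iff₀ ha, mul_one]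
      refine (ContinuousLinearMap.opNorm_comp_le _ _).trans ?_
      nlinarith [norm_nonneg A]
    simpa [weakBall, T] using hn
  have hadj : ∀ f, adj (A ∘L B ∘L C) f = (a : 𝕜) • (adj B (T f)).comp C := by
    intro f
    ext x
    change WeakDual.toStrongDual f (A (B (C x))) =
      (a : 𝕜) * (s * WeakDual.toStrongDual f (A (B (C x))))
    rw [← mul_assoc, hsa, one_mul]
  refine ⟨fun f => ρ (T f), fun f hf => ⟨(hρ _ (hTm hf)).1, ?_⟩⟩
  have ht : Tendsto T (𝓝[weakBall 𝕜 Z] f) (𝓝[weakBall 𝕜 Y] (T f)) :=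
    hTc.continuousWithinAt.tendsto_nhdsWithin hTm
  filter_upwards [ht.eventually (hρ _ (hTm hf)).2] with g hg
  refine ⟨hg.1, fun h => ?_⟩
  have hle := hg.2 h
  have hsub : adj (A ∘L B ∘L C) g - adj (A ∘L B ∘L C) f =
      (a : 𝕜) • (adj B (T g) - adj B (T f)).comp C := by
    rw [hadj, hadj, ContinuousLinearMap.sub_comp]
    exact (smul_sub _ _ _).symm
  rw [hsub, norm_smul, RCLike.norm_ofReal, abs_of_pos ha]
  calc a * ‖(adj B (T g) - adj B (T f)).comp C‖
      ≤ a * (‖adj B (T g) - adj B (T f)‖ * ‖C‖) := by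
        gcongr; exact ContinuousLinearMap.opNorm_comp_le _ _
    _ ≤ a * (ε / (a * c) * c) := by
        gcongr; rw [hc_def]; linarith
    _ = ε := by field_simp

theorem HasRank.smul {A : X →L[𝕜] Y} {θ : Ordinal.{v}} (hA : HasRank A θ) (c : 𝕜) :
    HasRank (c • A) θ := by
  convert hA.comp (c • ContinuousLinearMap.id 𝕜 Y) (ContinuousLinearMap.id 𝕜 X) using 1
  ext x
  simp

theorem isClosed_setOf_hasRank {θ : Ordinal.{v}} : IsClosed {A : X →L[𝕜] Y | HasRank A θ} := by
  refine isClosed_of_closure_subset fun A hA ε hε => ?_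
  obtain ⟨B, hB, hAB⟩ := Metric.mem_closure_iff.1 hA (ε / 4) (by positivity)
  obtain ⟨ρ, hρ⟩ := hB (ε / 2) (by positivity)
  refine ⟨ρ, fun f hf => ⟨(hρ f hf).1, ?_⟩⟩
  have happrox : ∀ g ∈ weakBall 𝕜 Y, ‖adj A g - adj B g‖ ≤ ε / 4 := by
    intro g hg
    have hg' : ‖WeakDual.toStrongDual g‖ ≤ 1 := by simpa [weakBall] using hg
    have : adj A g - adj B g = (WeakDual.toStrongDual g).comp (A - B) :=
      (ContinuousLinearMap.comp_sub ..).symm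
    rw [this]
    refine (ContinuousLinearMap.opNorm_comp_le _ _).trans ?_
    rw [dist_eq_norm] at hAB
    nlinarith [norm_nonneg (A - B)]
  filter_upwards [(hρ f hf).2, self_mem_nhdsWithin] with g hg hgB
  refine ⟨hg.1, fun h => ?_⟩
  have h1 := happrox g hgB
  have h2 := happrox f hf
  have h3 := hg.2 h
  simp only [← dist_eq_norm] at h1 h2 h3 ⊢
  -- Error budget: `ε/4` for each replacement of `A` by `B`, `ε/2` for the oscillation of `B^*`.
  have h4 := dist_triangle4_right (adj A g) (adj A f) (adj B g) (adj B f)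
  linarith

theorem hasRank_id_of_finiteDimensional [FiniteDimensional 𝕜 X] {θ : Ordinal.{v}} (hθ : 0 < θ) :
    HasRank (ContinuousLinearMap.id 𝕜 X) θ := by
  refine fun ε hε => ⟨fun _ => 0, fun f _ => ⟨hθ, nhdsWithin_le_nhds ?_⟩⟩
  -- In finite dimension weak* convergence is norm convergence, so a constant rank suffices.
  have hc : Continuous (WeakDual.toStrongDual : WeakDual 𝕜 X ≃ₗ[𝕜] StrongDual 𝕜 X) := by
    have : FiniteDimensional 𝕜 (WeakDual 𝕜 X) :=
      (WeakDual.toStrongDual : WeakDual 𝕜 X ≃ₗ[𝕜] StrongDual 𝕜 X).symm.finiteDimensional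
    exact LinearMap.continuous_of_finiteDimensional
      (WeakDual.toStrongDual : WeakDual 𝕜 X ≃ₗ[𝕜] StrongDual 𝕜 X).toLinearMap
  filter_upwards [hc.continuousAt.eventually (Metric.closedBall_mem_nhds _ hε)] with g hg
  refine ⟨le_rfl, fun _ => ?_⟩
  exact (dist_eq_norm _ _).symm.trans_le hg

end Rank

theorem mem_szlenkClass_iff {𝕜 : Type} [RCLike 𝕜] {ξ : Ordinal.{v}} {X Y : Type u}
    [NormedAddCommGroup X] [NormedSpace 𝕜 X] [CompleteSpace X]
    [NormedAddCommGroup Y] [NormedSpace 𝕜 Y] [CompleteSpace Y] {A : X →L[𝕜] Y} :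
    A ∈ szlenkClass.{u, v} 𝕜 ξ X Y ↔ HasRank A ((ω : Ordinal.{v}) ^ ξ) :=
  opIndex_le_iff_hasRank

end Szlenk

end

theorem mainTheorem11 (𝕜 : Type) [RCLike 𝕜] (ξ : Ordinal.{v}) :
    Szlenk.IsClosedOperatorIdeal.{u} (Szlenk.szlenkClass.{u, v} 𝕜 ξ) where
  comp_mem W X Y Z _ _ _ _ _ _ _ _ _ _ _ _ C B A hB :=
    Szlenk.mem_szlenkClass_iff.2 ((Szlenk.mem_szlenkClass_iff.1 hB).comp A C)
  id_mem := by
    have : FiniteDimensional 𝕜 (ULift.{u} 𝕜) := ULift.moduleEquiv.symm.finiteDimensional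
    exact Szlenk.mem_szlenkClass_iff.2
      (Szlenk.hasRank_id_of_finiteDimensional (Ordinal.opow_pos ξ Ordinal.omega0_pos))
  isSubspace X Y _ _ _ _ _ _ :=
    ⟨{ carrier := Szlenk.szlenkClass.{u, v} 𝕜 ξ X Y
       add_mem' := fun hA hB => Szlenk.mem_szlenkClass_iff.2
        ((Szlenk.mem_szlenkClass_iff.1 hA).add (Szlenk.nadd_lt_omega0_opow ξ)
          (Szlenk.mem_szlenkClass_iff.1 hB))
       zero_mem' := Szlenk.mem_szlenkClass_iff.2
        (Szlenk.hasRank_zero (Ordinal.opow_pos ξ Ordinal.omega0_pos))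
       smul_mem' := fun c _ hA => Szlenk.mem_szlenkClass_iff.2
        ((Szlenk.mem_szlenkClass_iff.1 hA).smul c) }, rfl⟩
  isClosed X Y _ _ _ _ _ _ := by
    have h : Szlenk.szlenkClass.{u, v} 𝕜 ξ X Y =
        {A : X →L[𝕜] Y | Szlenk.HasRank A (Ordinal.omega0.{v} ^ ξ)} :=
      Set.ext fun _ => Szlenk.mem_szlenkClass_iff
    rw [h]
    exact Szlenk.isClosed_setOf_hasRank
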